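/- Let $\mathbb{K}$ be $\mathbb{R}$ or $\mathbb{C}$, let $d,N\ge 1$ be integers, let $M_d$ be the space of $d\times d$ matrices over $\mathbb{K}$, let $X\in M_d$ have full rank $d$, and let $1<p<\infty$. Let $$\mathcal{F}_X=\{(W_N,\dots,W_1)\in M_d^N : W_NW_{N-1}\cdots W_1=X\}$$ be the fiber over $X$, and let the balanced manifold $\mathcal{M}$ be the set of all $\mathbf{W}=(W_N,\dots,W_1)\in M_d^N$ whose product $W_N\cdots W_1$ has rank $d$ and which satisfy $$W_{k+1}^*W_{k+1}=W_kW_k^*,\qquad 1\le k\le N-1,$$ where $^*$ denotes the conjugate transpose. Put $\|\mathbf{W}\|_p=\sum_{k=1}^N\|W_k\|_p$, where $\|A\|_p=\bigl(\sum_{i=1}^d\sigma_i(A)^p\bigr)^{1/p}$ is the Schatten $p$-norm and $\sigma_1(A),\dots,\sigma_d(A)$ are the singular values of $A$. Then $$\operatorname*{arg\,min}_{\mathbf{W}\in\mathcal{F}_X}\|\mathbf{W}\|_p=\mathcal{F}_X\cap\mathcal{M},$$ that is, $\mathbf{W}\in\mathcal{F}_X$ satisfies $\|\mathbf{W}\|_p\le\|\mathbf{W}'\|_p$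 for all $\mathbf{W}'\in\mathcal{F}_X$ if and only if $\mathbf{W}$ is balanced. -/

import Mathlib

namespace DLN

/-- A tuple `(W_N, …, W_1)` of `N` square matrices of size `d`. The matrix `W_k` of the usual
one-based numbering is `W (k - 1)`. -/
abbrev Weights (𝕜 : Type*) (d N : ℕ) : Type _ := Fin N → Matrix (Fin d) (Fin d) 𝕜

/-- The end-to-end matrix `W_N * W_{N-1} * ⋯ * W_1`. -/
def endToEnd {𝕜 : Type*} [RCLike 𝕜] {d N : ℕ} (W : Weights 𝕜 d N) : Matrix (Fin d) (Fin d) 𝕜 :=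
  (List.ofFn W).reverse.prod

/-- The fiber over `X`: all tuples whose end-to-end matrix is `X`. -/
def fiber {𝕜 : Type*} [RCLike 𝕜] {d : ℕ} (N : ℕ) (X : Matrix (Fin d) (Fin d) 𝕜) :
    Set (Weights 𝕜 d N) :=
  {W | endToEnd W = X}

/-- The balanced variety: `W_{k+1}ᴴ * W_{k+1} = W_k * W_kᴴ` for all `1 ≤ k ≤ N - 1`. -/
def balancedVariety (𝕜 : Type*) [RCLike 𝕜] (d N : ℕ) : Set (Weights 𝕜 d N) :=
  {W | ∀ (k : ℕ) (hk : k + 1 < N),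
    (W ⟨k + 1, hk⟩).conjTranspose * W ⟨k + 1, hk⟩ =
      W ⟨k, Nat.lt_of_succ_lt hk⟩ * (W ⟨k, Nat.lt_of_succ_lt hk⟩).conjTranspose}

/-- The balanced manifold: the leaf of the balanced variety on which the rank is full. -/
def balancedManifold (𝕜 : Type*) [RCLike 𝕜] (d N : ℕ) : Set (Weights 𝕜 d N) :=
  {W | W ∈ balancedVariety 𝕜 d N ∧ (endToEnd W).rank = d}

/-- The Schatten `p`-norm of a square matrix: the `ℓ^p` norm of its singular values. -/
noncomputable def schattenNorm {𝕜 : Type*} [RCLike 𝕜] {d : ℕ} (p : ℝ)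
    (A : Matrix (Fin d) (Fin d) 𝕜) : ℝ :=
  (∑ i ∈ Finset.range d, (Matrix.toEuclideanLin A).singularValues i ^ p) ^ (1 / p)

/-- The summed Schatten norm `∑ k, ‖W_k‖_p` of a tuple. -/
noncomputable def summedSchattenNorm {𝕜 : Type*} [RCLike 𝕜] {d N : ℕ} (p : ℝ)
    (W : Weights 𝕜 d N) : ℝ :=
  ∑ k, schattenNorm p (W k)

end DLN

/-! Write `‖A‖_p` as `(tr (Aᴴ A)^(p/2))^(1/p)`. No convexity is needed; the theorem follows from
three facts about the fiber of an invertible `X`.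

A minimizer is balanced (`balanced_of_isMinOn`). Replacing neighbours `(A, B) = (W_{k+1}, W_k)` by
`(A G, G⁻¹ B)` stays in the fiber. Take `G = exp(-tD)` with `D` Hermitian, and put `P = Aᴴ A`, `Q =
B Bᴴ`. The derivative of the two norms at `t = 0` is `-Re tr ((a P^(p/2) - b Q^(p/2)) D)` with
positive scalars `a`, `b`. Choosing `D` to be the bracket forces it to vanish, and comparing traces
gives `a = b`, hence `P = Q`.

A minimizer exists (`exists_isMinOn_fiber`), by compactness of sublevel sets in the closed fiber.

All balanced points of the fiber have the same value (`summedSchattenNorm_eq_of_balanced`):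
balancedness telescopes `Xᴴ X` to `(W_1ᴴ W_1)^N`, so the value depends on `X` only. It is therefore
the value at a minimizer. -/

namespace DLN

open Matrix Filter Topology
open scoped ComplexOrder

/-! ### Differentiability of `A ↦ tr A^q` at positive definite matrices. -/

section SpectralTrace

variable {𝕜 : Type*} [RCLike 𝕜] {n : Type*} [Fintype n] [DecidableEq n]

/-- The trace of `f(A)`, as a real number. -/
noncomputable def spectralTrace (f : ℝ → ℝ) (A : Matrix n n 𝕜) : ℝ :=
  RCLike.re (cfc f A).trace

theorem continuousOn_spectrum (f : ℝ → ℝ) (A : Matrix n n 𝕜) :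
    ContinuousOn f (spectrum ℝ A) :=
  A.finite_real_spectrum.continuousOn f

theorem cfc_eq_conj (f : ℝ → ℝ) {A : Matrix n n 𝕜} (hA : A.IsHermitian) :
    cfc f A = (hA.eigenvectorUnitary : Matrix n n 𝕜) *
      diagonal (fun i => ((f (hA.eigenvalues i) : ℝ) : 𝕜)) *
        star (hA.eigenvectorUnitary : Matrix n n 𝕜) := by
  rw [hA.cfc_eq, IsHermitian.cfc, Unitary.conjStarAlgAut_apply]
  rfl

theorem spectralTrace_eq_sum (f : ℝ → ℝ) {A : Matrix n n 𝕜} (hA : A.IsHermitian) :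
    spectralTrace f A = ∑ i, f (hA.eigenvalues i) := by
  rw [spectralTrace, cfc_eq_conj f hA, trace_mul_comm, ← mul_assoc]
  simp [trace_diagonal]

/-- The doubly stochastic matrix that compares the eigenbases of two Hermitian matrices. -/
noncomputable def overlap {A B : Matrix n n 𝕜} (hA : A.IsHermitian) (hB : B.IsHermitian)
    (i j : n) : ℝ :=
  ‖(star (hA.eigenvectorUnitary : Matrix n n 𝕜) * (hB.eigenvectorUnitary : Matrix n n 𝕜)) i j‖ ^ 2

theorem overlap_nonneg {A B : Matrix n n 𝕜} (hA : A.IsHermitian) (hB : B.IsHermitian)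
    (i j : n) : 0 ≤ overlap hA hB i j := by
  unfold overlap; positivity

/-- In the two eigenbases the trace becomes a double sum with nonnegative weights, so scalar
inequalities in pairs of eigenvalues transfer to traces even when `A` and `B` do not commute. -/
theorem re_trace_cfc_mul_cfc (f g : ℝ → ℝ) {A B : Matrix n n 𝕜} (hA : A.IsHermitian)
    (hB : B.IsHermitian) :
    RCLike.re (cfc f A * cfc g B).trace =
      ∑ i, ∑ j, overlap hA hB i j * (f (hA.eigenvalues i) * g (hB.eigenvalues j)) := by
  rw [cfc_eq_conj f hA, cfc_eq_conj g hB]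
  set U := (hA.eigenvectorUnitary : Matrix n n 𝕜)
  set V := (hB.eigenvectorUnitary : Matrix n n 𝕜)
  set D := diagonal (fun i => ((f (hA.eigenvalues i) : ℝ) : 𝕜))
  set E := diagonal (fun i => ((g (hB.eigenvalues i) : ℝ) : 𝕜))
  have h : (U * D * star U * (V * E * star V)).trace
      = (D * (star U * V) * E * (star U * V)ᴴ).trace := by
    rw [show U * D * star U * (V * E * star V) = U * (D * star U * (V * E * star V)) by
      simp only [mul_assoc], trace_mul_comm]
    simp only [conjTranspose_mul, star_eq_conjTranspose, conjTranspose_conjTranspose, mul_assoc]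
  rw [h, trace, map_sum]
  refine Finset.sum_congr rfl fun i _ => ?_
  rw [diag_apply, mul_apply, map_sum]
  refine Finset.sum_congr rfl fun j _ => ?_
  simp only [E, D, mul_diagonal, diagonal_mul, conjTranspose_apply]
  have h2 : ∀ (a b : ℝ) (z : 𝕜), RCLike.re ((a : 𝕜) * z * (b : 𝕜) * star z) = ‖z‖ ^ 2 * (a * b) := by
    intro a b z
    rw [show (a : 𝕜) * z * (b : 𝕜) * star z = (a : 𝕜) * (b : 𝕜) * (z * star z) by ring,
      RCLike.star_def, RCLike.mul_conj]
    norm_cast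
    ring
  exact h2 _ _ _

theorem abs_spectralTrace_sub_le (f f' : ℝ → ℝ) {A B : Matrix n n 𝕜} (hA : A.IsHermitian)
    (hB : B.IsHermitian) (C : ℝ)
    (h : ∀ i j, |f (hA.eigenvalues i) - f (hB.eigenvalues j) -
      f' (hB.eigenvalues j) * (hA.eigenvalues i - hB.eigenvalues j)| ≤
        C * (hA.eigenvalues i - hB.eigenvalues j) ^ 2) :
    |spectralTrace f A - spectralTrace f B - RCLike.re (cfc f' B * (A - B)).trace| ≤
      C * RCLike.re ((A - B) * (A - B)).trace := by
  have hA' : IsSelfAdjoint A := hA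
  have hB' : IsSelfAdjoint B := hB
  -- Each term is put in the form `tr (g(A) h(B))`, inserting the constant function 1 where needed,
  -- so that all of them share the same weights.
  have e1 : spectralTrace f A = RCLike.re (cfc f A * cfc (fun _ => (1 : ℝ)) B).trace := by
    rw [cfc_const_one ℝ B, mul_one]; rfl
  have e2 : spectralTrace f B = RCLike.re (cfc (fun _ => (1 : ℝ)) A * cfc f B).trace := by
    rw [cfc_const_one ℝ A, one_mul]; rfl
  have e3 : RCLike.re (cfc f' B * (A - B)).trace =
      RCLike.re (cfc (fun x : ℝ => x) A * cfc f' B).trace -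
        RCLike.re (cfc (fun _ => (1 : ℝ)) A * cfc (fun x => f' x * x) B).trace := by
    rw [cfc_const_one ℝ A, one_mul, cfc_id' ℝ A,
      cfc_mul (R := ℝ) f' (fun x : ℝ => x) B (continuousOn_spectrum _ _) (continuousOn_spectrum _ _),
      cfc_id' ℝ B, mul_sub, trace_sub, map_sub, trace_mul_comm A]
  have e4 : RCLike.re ((A - B) * (A - B)).trace =
      RCLike.re (cfc (fun x : ℝ => x ^ 2) A * cfc (fun _ => (1 : ℝ)) B).trace
      - 2 * RCLike.re (cfc (fun x : ℝ => x) A * cfc (fun x : ℝ => x) B).trace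
      + RCLike.re (cfc (fun _ => (1 : ℝ)) A * cfc (fun x : ℝ => x ^ 2) B).trace := by
    rw [cfc_const_one ℝ A, one_mul, cfc_id' ℝ A, cfc_const_one ℝ B, mul_one, cfc_id' ℝ B,
      cfc_pow_id (R := ℝ) A 2, cfc_pow_id (R := ℝ) B 2, sub_mul, mul_sub, mul_sub]
    simp only [trace_sub, map_sub, trace_mul_comm B A, pow_two]
    ring
  rw [e1, e2, e3, e4]
  simp only [re_trace_cfc_mul_cfc _ _ hA hB, Finset.mul_sum, ← Finset.sum_sub_distrib,
    ← Finset.sum_add_distrib]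
  refine (Finset.abs_sum_le_sum_abs _ _).trans (Finset.sum_le_sum fun i _ => ?_)
  refine (Finset.abs_sum_le_sum_abs _ _).trans (Finset.sum_le_sum fun j _ => ?_)
  have hw := overlap_nonneg hA hB i j
  calc _ = |overlap hA hB i j * (f (hA.eigenvalues i) - f (hB.eigenvalues j) -
      f' (hB.eigenvalues j) * (hA.eigenvalues i - hB.eigenvalues j))| := by congr 1; ring
    _ ≤ overlap hA hB i j * (C * (hA.eigenvalues i - hB.eigenvalues j) ^ 2) := by
      rw [abs_mul, abs_of_nonneg hw]
      exact mul_le_mul_of_nonneg_left (h i j) hw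
    _ = _ := by ring

theorem rpow_sub_linear_isBigO (q : ℝ) {y : ℝ} (hy : 0 < y) :
    (fun x : ℝ => x ^ q - y ^ q - q * y ^ (q - 1) * (x - y)) =O[𝓝 y] fun x => (x - y) ^ 2 := by
  have hc : ContDiffOn ℝ 2 (fun x : ℝ => x ^ q) (Set.Ioi 0) := fun x hx =>
    (contDiffAt_id.rpow_const_of_ne (ne_of_gt hx)).contDiffWithinAt
  have ht := taylor_isLittleO (n := 2) (convex_Ioi 0) (Set.mem_Ioi.2 hy) hc
  rw [isOpen_Ioi.nhdsWithin_eq (Set.mem_Ioi.2 hy)] at ht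
  have hd : iteratedDerivWithin 1 (fun x : ℝ => x ^ q) (Set.Ioi 0) y = q * y ^ (q - 1) := by
    rw [iteratedDerivWithin_one, derivWithin_of_isOpen isOpen_Ioi (Set.mem_Ioi.2 hy),
      Real.deriv_rpow_const]
  -- The second-order Taylor term is moved into the quadratic error.
  have h2 : (fun x : ℝ => x ^ q - y ^ q - q * y ^ (q - 1) * (x - y)) =
      fun x => (x ^ q - taylorWithinEval (fun x : ℝ => x ^ q) 2 (Set.Ioi 0) y x) +
        (2⁻¹ * iteratedDerivWithin 2 (fun x : ℝ => x ^ q) (Set.Ioi 0) y) * (x - y) ^ 2 := by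
    funext x
    simp [taylorWithinEval_succ, hd]
    ring
  rw [h2]
  exact ht.isBigO.add (Asymptotics.isBigO_const_mul_self _ _ _)

/-- Near `y` this is Taylor's bound; away from `y` the left side is bounded by compactness and `(x -
y)^2` is bounded below. The interval includes 0, where `x ^ q` need not be smooth. -/
theorem exists_abs_rpow_sub_linear_le {q : ℝ} (hq : 0 < q) {y : ℝ} (hy : 0 < y) (M : ℝ) :
    ∃ C : ℝ, ∀ x ∈ Set.Icc 0 M,
      |x ^ q - y ^ q - q * y ^ (q - 1) * (x - y)| ≤ C * (x - y) ^ 2 := by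
  obtain ⟨C₁, h₁⟩ := (rpow_sub_linear_isBigO q hy).bound
  obtain ⟨δ, hδ, h₁⟩ := Metric.eventually_nhds_iff.1 h₁
  have hcont : ContinuousOn (fun x : ℝ => x ^ q - y ^ q - q * y ^ (q - 1) * (x - y))
      (Set.Icc 0 M) := by
    have := Real.continuous_rpow_const hq.le
    fun_prop
  obtain ⟨K, hK⟩ := isCompact_Icc.exists_bound_of_continuousOn hcont
  refine ⟨max C₁ (|K| / δ ^ 2), fun x hx => ?_⟩
  by_cases hxy : dist x y < δ
  · have := h₁ hxy
    rw [Real.norm_eq_abs, Real.norm_eq_abs, abs_of_nonneg (sq_nonneg (x - y))] at this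
    exact this.trans (mul_le_mul_of_nonneg_right (le_max_left _ _) (sq_nonneg _))
  · rw [not_lt, Real.dist_eq] at hxy
    have h3 : δ ^ 2 ≤ (x - y) ^ 2 := by
      rw [← sq_abs (x - y)]; exact pow_le_pow_left₀ hδ.le hxy 2
    calc _ ≤ |K| := (hK x hx).trans (le_abs_self K)
      _ = |K| / δ ^ 2 * δ ^ 2 := by field_simp
      _ ≤ |K| / δ ^ 2 * (x - y) ^ 2 := by gcongr
      _ ≤ _ := mul_le_mul_of_nonneg_right (le_max_right _ _) (sq_nonneg _)

/-- The trace bound confines the eigenvalues of `A` to `[0, M]`, so one constant serves all such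
`A`. Continuity and differentiability both follow from this estimate. -/
theorem exists_abs_spectralTrace_rpow_sub_le {q : ℝ} (hq : 0 < q) {B : Matrix n n 𝕜}
    (hB : B.PosDef) (M : ℝ) :
    ∃ C : ℝ, ∀ A : Matrix n n 𝕜, A.PosSemidef → RCLike.re A.trace ≤ M →
      |spectralTrace (· ^ q) A - spectralTrace (· ^ q) B -
        RCLike.re (cfc (fun x => q * x ^ (q - 1)) B * (A - B)).trace| ≤
      C * RCLike.re ((A - B) * (A - B)).trace := by
  choose C hC using fun j => exists_abs_rpow_sub_linear_le hq (hB.eigenvalues_pos j) M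
  refine ⟨∑ j, |C j|, fun A hA hM => ?_⟩
  refine abs_spectralTrace_sub_le (· ^ q) (fun x => q * x ^ (q - 1)) hA.1 hB.1 _ fun i j => ?_
  have hi : hA.1.eigenvalues i ≤ M := by
    rw [hA.1.trace_eq_sum_eigenvalues, map_sum] at hM
    simp only [RCLike.ofReal_re] at hM
    exact (Finset.single_le_sum (fun k _ => hA.eigenvalues_nonneg k) (Finset.mem_univ i)).trans hM
  refine (hC j _ ⟨hA.eigenvalues_nonneg i, hi⟩).trans
    (mul_le_mul_of_nonneg_right ?_ (sq_nonneg _))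
  exact (le_abs_self _).trans
    (Finset.single_le_sum (f := fun j => |C j|) (fun k _ => abs_nonneg _) (Finset.mem_univ j))

theorem continuousWithinAt_spectralTrace_rpow {q : ℝ} (hq : 0 < q) {B : Matrix n n 𝕜}
    (hB : B.PosDef) :
    ContinuousWithinAt (spectralTrace (· ^ q)) {A : Matrix n n 𝕜 | A.PosSemidef} B := by
  obtain ⟨C, hC⟩ := exists_abs_spectralTrace_rpow_sub_le hq hB (RCLike.re B.trace + 1)
  have htr : Continuous fun A : Matrix n n 𝕜 => RCLike.re A.trace :=
    RCLike.continuous_re.comp continuous_id.matrix_trace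
  have hev : ∀ᶠ A in 𝓝[{A : Matrix n n 𝕜 | A.PosSemidef}] B,
      |spectralTrace (· ^ q) A - spectralTrace (· ^ q) B -
        RCLike.re (cfc (fun x => q * x ^ (q - 1)) B * (A - B)).trace| ≤
      C * RCLike.re ((A - B) * (A - B)).trace := by
    have h1 : ∀ᶠ A in 𝓝 B, RCLike.re A.trace < RCLike.re B.trace + 1 :=
      htr.continuousAt.eventually_lt continuousAt_const (by linarith)
    filter_upwards [self_mem_nhdsWithin, nhdsWithin_le_nhds h1] with A hA hA'
    exact hC A hA hA'.le
  have hl : Continuous fun A : Matrix n n 𝕜 =>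
      RCLike.re (cfc (fun x => q * x ^ (q - 1)) B * (A - B)).trace :=
    htr.comp (by fun_prop)
  have hr : Continuous fun A : Matrix n n 𝕜 => C * RCLike.re ((A - B) * (A - B)).trace :=
    continuous_const.mul (htr.comp (by fun_prop))
  have h0 : Tendsto (fun A => spectralTrace (· ^ q) A - spectralTrace (· ^ q) B -
        RCLike.re (cfc (fun x => q * x ^ (q - 1)) B * (A - B)).trace)
      (𝓝[{A : Matrix n n 𝕜 | A.PosSemidef}] B) (𝓝 0) := by
    refine squeeze_zero_norm' hev ?_
    have := (hr.tendsto B).mono_left (nhdsWithin_le_nhds (s := {A : Matrix n n 𝕜 | A.PosSemidef}))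
    simpa using this
  have h1 := (h0.add ((hl.tendsto B).mono_left nhdsWithin_le_nhds)).add_const
    (spectralTrace (· ^ q) B)
  simpa [ContinuousWithinAt] using h1

attribute [local instance] Matrix.linftyOpNormedRing Matrix.linftyOpNormedAlgebra

theorem hasDerivAt_re_trace {F : ℝ → Matrix n n 𝕜} {F' : Matrix n n 𝕜} {t : ℝ}
    (hF : HasDerivAt F F' t) :
    HasDerivAt (fun s => RCLike.re (F s).trace) (RCLike.re F'.trace) t := by
  let ℓ : Matrix n n 𝕜 →ₗ[ℝ] ℝ := RCLike.reLm.comp ((traceLinearMap n 𝕜 𝕜).restrictScalars ℝ)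
  exact (LinearMap.toContinuousLinearMap ℓ).hasFDerivAt.comp_hasDerivAt t hF

theorem hasDerivAt_spectralTrace_rpow {q : ℝ} (hq : 0 < q) {F : ℝ → Matrix n n 𝕜}
    {F' : Matrix n n 𝕜} {t : ℝ} (hF : HasDerivAt F F' t) (hpos : (F t).PosDef)
    (hpsd : ∀ s, (F s).PosSemidef) :
    HasDerivAt (fun s => spectralTrace (· ^ q) (F s))
      (RCLike.re (cfc (fun x => q * x ^ (q - 1)) (F t) * F').trace) t := by
  obtain ⟨C, hC⟩ := exists_abs_spectralTrace_rpow_sub_le hq hpos (RCLike.re (F t).trace + 1)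
  have hev : ∀ᶠ s in 𝓝 t, RCLike.re (F s).trace < RCLike.re (F t).trace + 1 :=
    (hasDerivAt_re_trace hF).continuousAt.eventually_lt continuousAt_const (by linarith)
  have hl : HasDerivAt (fun s => RCLike.re (cfc (fun x => q * x ^ (q - 1)) (F t) *
      (F s - F t)).trace) (RCLike.re (cfc (fun x => q * x ^ (q - 1)) (F t) * F').trace) t :=
    hasDerivAt_re_trace ((hF.sub_const (F t)).const_mul _)
  have hs := hasDerivAt_re_trace ((hF.sub_const (F t)).mul (hF.sub_const (F t)))
  have hz : HasDerivAt (fun s => spectralTrace (· ^ q) (F s) - spectralTrace (· ^ q) (F t) -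
      RCLike.re (cfc (fun x => q * x ^ (q - 1)) (F t) * (F s - F t)).trace) 0 t := by
    rw [hasDerivAt_iff_isLittleO] at hs ⊢
    simp only [sub_self, zero_mul, mul_zero, add_zero, trace_zero, map_zero, sub_zero,
      smul_zero, Pi.mul_apply] at hs ⊢
    refine Asymptotics.IsBigO.trans_isLittleO ?_ hs
    refine Asymptotics.IsBigO.of_bound |C| ?_
    filter_upwards [hev] with s h1
    refine (hC _ (hpsd s) h1.le).trans ((le_abs_self _).trans ?_)
    rw [abs_mul]; rfl
  have h := (hz.add hl).add_const (spectralTrace (· ^ q) (F t))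
  rw [zero_add] at h
  refine h.congr_of_eventuallyEq (Eventually.of_forall fun s => ?_)
  simp

end SpectralTrace

end DLN

namespace DLN

open Matrix Filter Topology
open scoped ComplexOrder

/-! ### Schatten norms as spectral traces of Gram matrices. -/

section SchattenNorm

variable {𝕜 : Type*} [RCLike 𝕜]

theorem spectralTrace_congr_charpoly {n : Type*} [Fintype n] [DecidableEq n] (f : ℝ → ℝ)
    {A B : Matrix n n 𝕜} (hA : A.IsHermitian) (hB : B.IsHermitian)
    (h : A.charpoly = B.charpoly) : spectralTrace f A = spectralTrace f B := by
  rw [spectralTrace_eq_sum f hA, spectralTrace_eq_sum f hB,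
    (hA.eigenvalues_eq_eigenvalues_iff hB).2 h]

theorem spectralTrace_conjTranspose_mul_self_comm {n : Type*} [Fintype n] [DecidableEq n]
    (f : ℝ → ℝ) (A : Matrix n n 𝕜) : spectralTrace f (Aᴴ * A) = spectralTrace f (A * Aᴴ) :=
  spectralTrace_congr_charpoly f (isHermitian_conjTranspose_mul_self A)
    (isHermitian_mul_conjTranspose_self A) (charpoly_mul_comm _ _)

theorem spectralTrace_rpow_pow {n : Type*} [Fintype n] [DecidableEq n] (q : ℝ) {m : ℕ}
    (hm : m ≠ 0) {A : Matrix n n 𝕜} (hA : A.PosSemidef) :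
    spectralTrace (· ^ (q / m)) (A ^ m) = spectralTrace (· ^ q) A := by
  have hA' : IsSelfAdjoint A := hA.1
  rw [spectralTrace, ← cfc_comp_pow (R := ℝ) (fun x : ℝ => x ^ (q / m)) m A
    ((A.finite_real_spectrum.image _).continuousOn _) hA']
  change spectralTrace _ A = _
  rw [spectralTrace_eq_sum _ hA.1, spectralTrace_eq_sum _ hA.1]
  refine Finset.sum_congr rfl fun i _ => ?_
  rw [← Real.rpow_natCast, ← Real.rpow_mul (hA.eigenvalues_nonneg i)]
  congr 1
  field_simp

theorem cfc_rpow_injOn_posSemidef {n : Type*} [Fintype n] [DecidableEq n] {q : ℝ} (hq : q ≠ 0)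
    {A B : Matrix n n 𝕜} (hA : A.PosSemidef) (hB : B.PosSemidef)
    (h : cfc (fun x : ℝ => x ^ q) A = cfc (fun x : ℝ => x ^ q) B) : A = B := by
  have key : ∀ {A : Matrix n n 𝕜}, A.PosSemidef →
      cfc (fun x : ℝ => x ^ q⁻¹) (cfc (fun x : ℝ => x ^ q) A) = A := by
    intro A hA
    have hA' : IsSelfAdjoint A := hA.1
    rw [← cfc_comp' (R := ℝ) (fun x : ℝ => x ^ q⁻¹) (fun x : ℝ => x ^ q) A
      ((A.finite_real_spectrum.image _).continuousOn _) (continuousOn_spectrum _ _) hA']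
    conv_rhs => rw [← cfc_id' ℝ A]
    refine cfc_congr fun x hx => ?_
    rw [hA.1.spectrum_real_eq_range_eigenvalues] at hx
    obtain ⟨i, rfl⟩ := hx
    exact Real.rpow_rpow_inv (hA.eigenvalues_nonneg i) hq
  rw [← key hA, h, key hB]

theorem spectralTrace_rpow_pos {n : Type*} [Fintype n] [DecidableEq n] [Nonempty n] (q : ℝ)
    {A : Matrix n n 𝕜} (hA : A.PosDef) : 0 < spectralTrace (· ^ q) A := by
  rw [spectralTrace_eq_sum _ hA.1]
  exact Finset.sum_pos (fun i _ => Real.rpow_pos_of_pos (hA.eigenvalues_pos i) q)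
    Finset.univ_nonempty

theorem spectralTrace_rpow_nonneg {n : Type*} [Fintype n] [DecidableEq n] (q : ℝ)
    {A : Matrix n n 𝕜} (hA : A.PosSemidef) : 0 ≤ spectralTrace (· ^ q) A := by
  rw [spectralTrace_eq_sum _ hA.1]
  exact Finset.sum_nonneg fun i _ => Real.rpow_nonneg (hA.eigenvalues_nonneg i) q

variable {d : ℕ}

theorem toEuclideanLin_conjTranspose_mul_self (A : Matrix (Fin d) (Fin d) 𝕜) :
    Matrix.toEuclideanLin (Aᴴ * A) =
      (Matrix.toEuclideanLin A).adjoint ∘ₗ Matrix.toEuclideanLin A := by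
  rw [← Matrix.toEuclideanLin_conjTranspose_eq_adjoint]
  ext x
  simp [Matrix.toLpLin_apply]

theorem eigenvalues_congr {E : Type*} [NormedAddCommGroup E] [InnerProductSpace 𝕜 E]
    [FiniteDimensional 𝕜 E] {m : ℕ} (hm : Module.finrank 𝕜 E = m) {S T : E →ₗ[𝕜] E}
    (hS : S.IsSymmetric) (hT : T.IsSymmetric) (h : S = T) :
    hS.eigenvalues hm = hT.eigenvalues hm := by
  subst h; rfl

theorem eigenvalues₀_conjTranspose_mul_self (A : Matrix (Fin d) (Fin d) 𝕜)
    (i : Fin (Fintype.card (Fin d))) :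
    (isHermitian_conjTranspose_mul_self A).eigenvalues₀ i =
      (Matrix.toEuclideanLin A).isSymmetric_adjoint_comp_self.eigenvalues
        finrank_euclideanSpace i :=
  congrFun (eigenvalues_congr finrank_euclideanSpace _ _
    (toEuclideanLin_conjTranspose_mul_self A)) i

theorem singularValues_fin_rpow {E F : Type*} [NormedAddCommGroup E] [InnerProductSpace 𝕜 E]
    [FiniteDimensional 𝕜 E] [NormedAddCommGroup F] [InnerProductSpace 𝕜 F]
    [FiniteDimensional 𝕜 F] (T : E →ₗ[𝕜] F) {m : ℕ} (hm : Module.finrank 𝕜 E = m) (i : Fin m)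
    (p : ℝ) :
    T.singularValues i ^ p = T.isSymmetric_adjoint_comp_self.eigenvalues hm i ^ (p / 2) := by
  have hnn := T.isPositive_adjoint_comp_self.nonneg_eigenvalues hm i
  rw [T.singularValues_fin hm, Real.sqrt_eq_rpow, ← Real.rpow_mul hnn, one_div_mul_eq_div]

theorem singularValues_rpow (p : ℝ) (A : Matrix (Fin d) (Fin d) 𝕜)
    (i : Fin (Fintype.card (Fin d))) :
    (Matrix.toEuclideanLin A).singularValues i ^ p =
      (isHermitian_conjTranspose_mul_self A).eigenvalues₀ i ^ (p / 2) :=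
  (singularValues_fin_rpow _ finrank_euclideanSpace i p).trans
    (congrArg (· ^ (p / 2)) (eigenvalues₀_conjTranspose_mul_self A i).symm)

theorem schattenNorm_eq (p : ℝ) (A : Matrix (Fin d) (Fin d) 𝕜) :
    schattenNorm p A = spectralTrace (· ^ (p / 2)) (Aᴴ * A) ^ (1 / p) := by
  have hH := isHermitian_conjTranspose_mul_self A
  have h1 : ∑ i, hH.eigenvalues i ^ (p / 2) = ∑ i, hH.eigenvalues₀ i ^ (p / 2) :=
    Equiv.sum_comp (Fintype.equivOfCardEq (Fintype.card_fin _)).symm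
      fun i => hH.eigenvalues₀ i ^ (p / 2)
  have h2 : Finset.range d = Finset.range (Fintype.card (Fin d)) := by rw [Fintype.card_fin]
  have h3 : ∑ i ∈ Finset.range d, (Matrix.toEuclideanLin A).singularValues i ^ p =
      spectralTrace (· ^ (p / 2)) (Aᴴ * A) := by
    rw [spectralTrace_eq_sum _ hH, h1, h2, Finset.sum_range]
    exact Finset.sum_congr rfl fun i _ => singularValues_rpow p A i
  rw [schattenNorm, h3]

theorem schattenNorm_eq' (p : ℝ) (A : Matrix (Fin d) (Fin d) 𝕜) :
    schattenNorm p A = spectralTrace (· ^ (p / 2)) (A * Aᴴ) ^ (1 / p) := by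
  rw [schattenNorm_eq, spectralTrace_conjTranspose_mul_self_comm]

theorem schattenNorm_nonneg (p : ℝ) (A : Matrix (Fin d) (Fin d) 𝕜) : 0 ≤ schattenNorm p A := by
  rw [schattenNorm_eq]
  exact Real.rpow_nonneg (spectralTrace_rpow_nonneg _ (posSemidef_conjTranspose_mul_self A)) _

/-- Coercivity, used for compactness: `tr (Aᴴ A)` is a sum of `d` squared singular values, each at
most `‖A‖_p^2`. -/
theorem norm_entry_sq_le {p : ℝ} (hp : 0 < p) (A : Matrix (Fin d) (Fin d) 𝕜) (i j : Fin d) :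
    ‖A i j‖ ^ 2 ≤ d * schattenNorm p A ^ 2 := by
  have hP := posSemidef_conjTranspose_mul_self A
  have hS := spectralTrace_rpow_nonneg (p / 2) hP
  have htr : RCLike.re (Aᴴ * A).trace = ∑ l, ∑ k, ‖A k l‖ ^ 2 := by
    simp only [trace, diag_apply, mul_apply, conjTranspose_apply, map_sum]
    refine Finset.sum_congr rfl fun l _ => Finset.sum_congr rfl fun k _ => ?_
    rw [RCLike.star_def, RCLike.conj_mul]
    norm_cast
  have hle : ‖A i j‖ ^ 2 ≤ RCLike.re (Aᴴ * A).trace := by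
    rw [htr]
    refine le_trans ?_ (Finset.single_le_sum
      (fun l _ => Finset.sum_nonneg fun k _ => sq_nonneg ‖A k l‖) (Finset.mem_univ j))
    exact Finset.single_le_sum (f := fun k => ‖A k j‖ ^ 2) (fun k _ => sq_nonneg _)
      (Finset.mem_univ i)
  refine hle.trans ?_
  rw [hP.1.trace_eq_sum_eigenvalues, map_sum]
  simp only [RCLike.ofReal_re]
  refine (Finset.sum_le_card_nsmul _ _ (schattenNorm p A ^ 2) fun k _ => ?_).trans
    (by simp)
  have hk := hP.eigenvalues_nonneg k
  have h1 : hP.1.eigenvalues k ^ (p / 2) ≤ spectralTrace (· ^ (p / 2)) (Aᴴ * A) := by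
    rw [spectralTrace_eq_sum _ hP.1]
    exact Finset.single_le_sum (f := fun k => hP.1.eigenvalues k ^ (p / 2))
      (fun l _ => Real.rpow_nonneg (hP.eigenvalues_nonneg l) _) (Finset.mem_univ k)
  have h2 := Real.rpow_le_rpow (Real.rpow_nonneg hk _) h1 (z := 2 / p) (by positivity)
  rw [← Real.rpow_mul hk, show p / 2 * (2 / p) = 1 by field_simp, Real.rpow_one] at h2
  refine h2.trans_eq ?_
  rw [schattenNorm_eq, ← Real.rpow_natCast, ← Real.rpow_mul hS]
  congr 1
  push_cast
  ring

theorem posDef_conjTranspose_mul_self {A : Matrix (Fin d) (Fin d) 𝕜} (hA : IsUnit A) :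
    (Aᴴ * A).PosDef :=
  PosDef.conjTranspose_mul_self A (mulVec_injective_iff_isUnit.2 hA)

theorem continuousAt_schattenNorm {p : ℝ} (hp : 0 < p) {A : Matrix (Fin d) (Fin d) 𝕜}
    (hA : IsUnit A) : ContinuousAt (schattenNorm p) A := by
  have h1 : ContinuousAt (fun B : Matrix (Fin d) (Fin d) 𝕜 =>
      spectralTrace (· ^ (p / 2)) (Bᴴ * B)) A := by
    have hc : Tendsto (fun B : Matrix (Fin d) (Fin d) 𝕜 => Bᴴ * B) (𝓝 A)
        (𝓝[{B | B.PosSemidef}] (Aᴴ * A)) := by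
      refine tendsto_nhdsWithin_iff.2 ⟨?_, Eventually.of_forall
        fun B => posSemidef_conjTranspose_mul_self B⟩
      exact (Continuous.matrix_mul (continuous_id.matrix_conjTranspose) continuous_id).tendsto A
    exact (continuousWithinAt_spectralTrace_rpow (by positivity)
      (posDef_conjTranspose_mul_self hA)).tendsto.comp hc
  have h2 : schattenNorm p = fun B : Matrix (Fin d) (Fin d) 𝕜 =>
      spectralTrace (· ^ (p / 2)) (Bᴴ * B) ^ (1 / p) := funext fun B => schattenNorm_eq p B
  rw [h2]
  exact h1.rpow_const (Or.inr (by positivity))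

end SchattenNorm

end DLN

namespace DLN

open Matrix

/-! ### Algebra of the end-to-end product. -/

section EndToEnd

variable {𝕜 : Type*} [RCLike 𝕜] {d : ℕ}

theorem endToEnd_succ {N : ℕ} (W : Weights 𝕜 d (N + 1)) :
    endToEnd W = endToEnd (fun k => W k.succ) * W 0 := by
  simp [endToEnd, List.ofFn_succ]

theorem continuous_endToEnd (N : ℕ) : Continuous (endToEnd : Weights 𝕜 d N → _) := by
  induction N with
  | zero => exact continuous_of_const fun V W => by rw [Subsingleton.elim V W]
  | succ N ih =>
    have : (endToEnd : Weights 𝕜 d (N + 1) → _) =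
        fun W => endToEnd (fun k => W k.succ) * W 0 := funext endToEnd_succ
    rw [this]
    exact Continuous.matrix_mul (ih.comp (continuous_pi fun k => continuous_apply k.succ))
      (continuous_apply 0)

theorem isUnit_of_isUnit_endToEnd {N : ℕ} {W : Weights 𝕜 d N} (hW : IsUnit (endToEnd W))
    (k : Fin N) : IsUnit (W k) := by
  induction N with
  | zero => exact k.elim0
  | succ N ih =>
    rw [endToEnd_succ, isUnit_iff_isUnit_det, det_mul, IsUnit.mul_iff] at hW
    refine Fin.cases ?_ (fun j => ?_) k
    · exact (isUnit_iff_isUnit_det _).2 hW.2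
    · exact ih (W := fun k => W k.succ) ((isUnit_iff_isUnit_det _).2 hW.1) j

theorem endToEnd_congr_adjacent {N : ℕ} {W W' : Weights 𝕜 d N} (k : ℕ) (hk : k + 1 < N)
    (hne : ∀ j : Fin N, (j : ℕ) ≠ k → (j : ℕ) ≠ k + 1 → W' j = W j)
    (hmul : W' ⟨k + 1, hk⟩ * W' ⟨k, Nat.lt_of_succ_lt hk⟩ =
      W ⟨k + 1, hk⟩ * W ⟨k, Nat.lt_of_succ_lt hk⟩) :
    endToEnd W' = endToEnd W := by
  induction k generalizing N with
  | zero =>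
    obtain ⟨M, rfl⟩ : ∃ M, N = M + 2 := ⟨N - 2, by omega⟩
    rw [endToEnd_succ W', endToEnd_succ W, endToEnd_succ (fun k => W' k.succ),
      endToEnd_succ (fun k => W k.succ), mul_assoc, mul_assoc]
    congr 1
    congr 1
    funext j
    exact hne _ (by simp) (by simp)
  | succ k ih =>
    obtain ⟨M, rfl⟩ : ∃ M, N = M + 1 := ⟨N - 1, by omega⟩
    rw [endToEnd_succ W', endToEnd_succ W, hne 0 (by simp) (by simp)]
    congr 1
    exact ih (by omega) (fun j h1 h2 => hne _ (by simpa using h1) (by simpa using h2)) hmul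

/-- Peeling off `W 0`, the inner Gram matrix is a power of `W_2ᴴ W_2 = W_1 W_1ᴴ`, and `A (B A)^m B =
(A B)^(m+1)`. -/
theorem conjTranspose_endToEnd_mul_self {N : ℕ} {W : Weights 𝕜 d (N + 1)}
    (hW : W ∈ balancedVariety 𝕜 d (N + 1)) :
    (endToEnd W)ᴴ * endToEnd W = ((W 0)ᴴ * W 0) ^ (N + 1) := by
  induction N with
  | zero => simp [endToEnd]
  | succ N ih =>
    have h1 := ih (W := fun k => W k.succ) fun k hk => hW (k + 1) (by omega)
    have h0 : (W (Fin.succ 0))ᴴ * W (Fin.succ 0) = W 0 * (W 0)ᴴ := hW 0 (by omega)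
    rw [endToEnd_succ, conjTranspose_mul,
      show (W 0)ᴴ * (endToEnd fun k => W k.succ)ᴴ * ((endToEnd fun k => W k.succ) * W 0) =
        (W 0)ᴴ * ((endToEnd fun k => W k.succ)ᴴ * (endToEnd fun k => W k.succ)) * W 0 by
          simp only [mul_assoc], h1, h0]
    have h : ∀ (A B : Matrix (Fin d) (Fin d) 𝕜) (m : ℕ), A * (B * A) ^ m * B = (A * B) ^ (m + 1) := by
      intro A B m
      rw [pow_succ, ← mul_assoc, ← mul_pow_mul]
    exact h _ _ _

end EndToEnd

end DLN

namespace DLN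

open Matrix Filter Topology
open scoped ComplexOrder

/-! ### First variation under rebalancing two adjacent factors. -/

section Variation

variable {𝕜 : Type*} [RCLike 𝕜] {d : ℕ}

/-- `D P + P D` is the velocity of `exp(tD) P exp(tD)` at 0. Since `P` commutes with its own
functions, both halves contribute `q tr (P^q D)`. -/
theorem re_trace_cfc_rpow_deriv {q : ℝ} {P : Matrix (Fin d) (Fin d) 𝕜} (hP : P.PosDef)
    (D : Matrix (Fin d) (Fin d) 𝕜) :
    RCLike.re (cfc (fun x => q * x ^ (q - 1)) P * (D * P + P * D)).trace =
      2 * q * RCLike.re (cfc (fun x : ℝ => x ^ q) P * D).trace := by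
  have hP' : IsSelfAdjoint P := hP.1
  have h1 : cfc (fun x : ℝ => q * x ^ (q - 1)) P * P = q • cfc (fun x : ℝ => x ^ q) P := by
    have h : cfc (fun x : ℝ => q * x ^ (q - 1)) P * P =
        cfc (fun x : ℝ => q * x ^ (q - 1)) P * cfc (fun x : ℝ => x) P := by rw [cfc_id' ℝ P]
    rw [h, ← cfc_mul (R := ℝ) _ _ P (continuousOn_spectrum _ _) (continuousOn_spectrum _ _),
      ← cfc_const_mul (R := ℝ) q _ P (continuousOn_spectrum _ _)]
    refine cfc_congr fun x hx => ?_
    rw [hP.1.spectrum_real_eq_range_eigenvalues] at hx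
    obtain ⟨i, rfl⟩ := hx
    have := hP.eigenvalues_pos i
    rw [mul_assoc, ← Real.rpow_add_one this.ne', sub_add_cancel]
  have h2 : P * cfc (fun x : ℝ => q * x ^ (q - 1)) P = q • cfc (fun x : ℝ => x ^ q) P := by
    have h := cfc_commute_cfc (R := ℝ) (fun x => x) (fun x : ℝ => q * x ^ (q - 1)) P
    rw [cfc_id' ℝ P] at h
    rw [h.eq, h1]
  rw [mul_add, trace_add, trace_mul_comm _ (D * P), mul_assoc, h2, ← mul_assoc _ P D, h1,
    trace_mul_comm D, smul_mul_assoc, trace_smul, map_add, RCLike.smul_re]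
  ring

attribute [local instance] Matrix.linftyOpNormedRing Matrix.linftyOpNormedAlgebra

theorem hasDerivAt_exp_conj (P D : Matrix (Fin d) (Fin d) 𝕜) :
    HasDerivAt (fun t : ℝ => NormedSpace.exp (t • D) * P * NormedSpace.exp (t • D))
      (D * P + P * D) 0 := by
  have h : HasDerivAt (fun t : ℝ => NormedSpace.exp (t • D)) D 0 := by
    have h := hasDerivAt_exp_smul_const (𝕂 := ℝ) D 0
    rwa [zero_smul, NormedSpace.exp_zero, one_mul] at h
  have h2 := (h.mul_const P).mul h
  rwa [zero_smul, NormedSpace.exp_zero, one_mul, mul_one] at h2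

theorem isHermitian_exp_smul {D : Matrix (Fin d) (Fin d) 𝕜} (hD : D.IsHermitian) (t : ℝ) :
    (NormedSpace.exp (t • D)).IsHermitian :=
  IsHermitian.exp (hD.smul (IsSelfAdjoint.all t))

theorem hasDerivAt_spectralTrace_exp_conj {p : ℝ} (hp : 0 < p)
    {P D : Matrix (Fin d) (Fin d) 𝕜} (hP : P.PosDef) (hD : D.IsHermitian)
    (hpos : 0 < spectralTrace (· ^ (p / 2)) P) :
    HasDerivAt (fun t : ℝ => spectralTrace (· ^ (p / 2))
        (NormedSpace.exp (t • D) * P * NormedSpace.exp (t • D)) ^ (1 / p))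
      (spectralTrace (· ^ (p / 2)) P ^ (1 / p - 1) *
        RCLike.re (cfc (fun x : ℝ => x ^ (p / 2)) P * D).trace) 0 := by
  have hz : NormedSpace.exp ((0 : ℝ) • D) * P * NormedSpace.exp ((0 : ℝ) • D) = P := by simp
  have h := hasDerivAt_spectralTrace_rpow (q := p / 2) (by positivity) (hasDerivAt_exp_conj P D)
    (by rw [hz]; exact hP) (fun s => by
      have := hP.posSemidef.mul_mul_conjTranspose_same (NormedSpace.exp (s • D))
      rwa [(isHermitian_exp_smul hD s).eq] at this)
  rw [hz, re_trace_cfc_rpow_deriv hP] at h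
  have h2 := h.rpow_const (p := 1 / p) (Or.inl (by rw [hz]; exact hpos.ne'))
  rw [hz] at h2
  convert! h2 using 1
  field_simp

theorem balanced_of_forall_le {p : ℝ} (hp : 0 < p) {A B : Matrix (Fin d) (Fin d) 𝕜}
    (hA : IsUnit A) (hB : IsUnit B)
    (hmin : ∀ G H : Matrix (Fin d) (Fin d) 𝕜, G * H = 1 →
      schattenNorm p A + schattenNorm p B ≤ schattenNorm p (A * G) + schattenNorm p (H * B)) :
    Aᴴ * A = B * Bᴴ := by
  rcases Nat.eq_zero_or_pos d with rfl | hd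
  · exact Subsingleton.elim _ _
  have : Nonempty (Fin d) := ⟨⟨0, hd⟩⟩
  have hP : (Aᴴ * A).PosDef := posDef_conjTranspose_mul_self hA
  have hQ : (B * Bᴴ).PosDef := by
    have := posDef_conjTranspose_mul_self (A := Bᴴ) (by
      rw [← star_eq_conjTranspose]; exact hB.star)
    rwa [conjTranspose_conjTranspose] at this
  set P := Aᴴ * A with hPdef
  set Q := B * Bᴴ with hQdef
  have hSP := spectralTrace_rpow_pos (p / 2) hP
  have hSQ := spectralTrace_rpow_pos (p / 2) hQ
  set x := spectralTrace (· ^ (p / 2)) P with hx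
  set y := spectralTrace (· ^ (p / 2)) Q with hy
  set R := cfc (fun x : ℝ => x ^ (p / 2)) P with hR
  set S := cfc (fun x : ℝ => x ^ (p / 2)) Q with hS
  have hRh : R.IsHermitian := cfc_predicate (R := ℝ) (p := IsSelfAdjoint) _ P
  have hSh : S.IsHermitian := cfc_predicate (R := ℝ) (p := IsSelfAdjoint) _ Q
  set a := x ^ (1 / p - 1) with ha
  set b := y ^ (1 / p - 1) with hb
  -- The steepest descent direction: the derivative along it is `-Re tr (D * D)`.
  set D := a • R - b • S with hDdef
  have hD : D.IsHermitian :=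
    (hRh.smul (IsSelfAdjoint.all a)).sub (hSh.smul (IsSelfAdjoint.all b))
  have hnD : (-D).IsHermitian := hD.neg
  have dP := hasDerivAt_spectralTrace_exp_conj hp hP hnD hSP
  have dQ := hasDerivAt_spectralTrace_exp_conj hp hQ hD hSQ
  have hloc : IsLocalMin (fun t : ℝ => spectralTrace (· ^ (p / 2))
        (NormedSpace.exp (t • (-D)) * P * NormedSpace.exp (t • (-D))) ^ (1 / p) +
      spectralTrace (· ^ (p / 2))
        (NormedSpace.exp (t • D) * Q * NormedSpace.exp (t • D)) ^ (1 / p)) 0 := by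
    refine Eventually.of_forall fun t => ?_
    have h1 : NormedSpace.exp (t • (-D)) * NormedSpace.exp (t • D) = 1 := by
      rw [← Matrix.exp_add_of_commute]
      · simp
      · simp only [smul_neg]
        exact (Commute.refl _).neg_left
    have h2 := hmin _ _ h1
    rw [schattenNorm_eq p A, schattenNorm_eq' p B, schattenNorm_eq p (A * _),
      schattenNorm_eq' p (_ * B), conjTranspose_mul, conjTranspose_mul,
      (isHermitian_exp_smul hnD t).eq, (isHermitian_exp_smul hD t).eq] at h2
    simp only [zero_smul, NormedSpace.exp_zero, one_mul, mul_one]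
    simpa only [hPdef, hQdef, mul_assoc] using h2
  have h0 := hloc.hasDerivAt_eq_zero (dP.add dQ)
  have h1 : RCLike.re (D * D).trace = 0 := by
    have : (D * D).trace = a • (R * D).trace - b • (S * D).trace := by
      conv_lhs => enter [1, 1]; rw [hDdef]
      rw [sub_mul, smul_mul_assoc, smul_mul_assoc, trace_sub, trace_smul, trace_smul]
    rw [this, map_sub, RCLike.smul_re, RCLike.smul_re]
    rw [mul_neg, trace_neg, map_neg] at h0
    linarith
  have h2 : D = 0 := by
    have hps := posSemidef_conjTranspose_mul_self D
    rw [hD.eq] at hps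
    have him : (D * D).trace = 0 := by
      have h3 := hps.trace_nonneg
      rw [RCLike.nonneg_iff] at h3
      exact RCLike.ext (by simpa using h1) (by simpa using h3.2)
    rwa [← trace_conjTranspose_mul_self_eq_zero_iff, hD.eq]
  have h3 : a • R = b • S := sub_eq_zero.1 h2
  -- Traces of `R` and `S` are `x` and `y`, so this says `x^(1/p) = y^(1/p)`.
  have h4 : a * x = b * y := by
    have := congrArg (fun M : Matrix (Fin d) (Fin d) 𝕜 => RCLike.re M.trace) h3
    simp only [trace_smul, RCLike.smul_re] at this
    exact this
  have h5 : x = y := by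
    rw [ha, hb, ← Real.rpow_add_one hSP.ne', ← Real.rpow_add_one hSQ.ne', sub_add_cancel] at h4
    exact (Real.rpow_left_inj hSP.le hSQ.le (by positivity)).1 h4
  have hab : a = b := by rw [ha, hb, h5]
  have ha0 : a ≠ 0 := (Real.rpow_pos_of_pos hSP _).ne'
  rw [← hab] at h3
  exact cfc_rpow_injOn_posSemidef (by positivity) hP.posSemidef hQ.posSemidef
    (smul_right_injective _ ha0 h3)

end Variation

/-! ### Existence of minimizers and the common value at balanced points. -/

section Minimizers

variable {𝕜 : Type*} [RCLike 𝕜] {d N : ℕ}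

theorem exists_isMinOn_fiber {p : ℝ} (hp : 0 < p) {X : Matrix (Fin d) (Fin d) 𝕜}
    (hX : IsUnit X) (hne : (fiber N X).Nonempty) :
    ∃ W ∈ fiber N X, IsMinOn (summedSchattenNorm p) (fiber N X) W := by
  obtain ⟨W₀, hW₀⟩ := hne
  -- Every factor of a point in the fiber is invertible, which is where continuity of the norm was
  -- established.
  have hcont : ContinuousOn (summedSchattenNorm p) (fiber N X) := by
    intro W hW
    have hW' : IsUnit (endToEnd W) := by rw [show endToEnd W = X from hW]; exact hX
    refine ContinuousAt.continuousWithinAt ?_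
    unfold summedSchattenNorm
    exact tendsto_finsetSum _ fun k _ =>
      (continuousAt_schattenNorm hp (isUnit_of_isUnit_endToEnd hW' k)).comp_of_eq
        (continuous_apply k).continuousAt rfl
  have hclosed : IsClosed (fiber N X) :=
    isClosed_eq (continuous_endToEnd N) continuous_const
  set c := summedSchattenNorm p W₀
  let K : Set (Weights 𝕜 d N) := Set.univ.pi fun _ => Set.univ.pi fun _ => Set.univ.pi fun _ =>
    Metric.closedBall 0 (√(d * c ^ 2))
  have hK : IsCompact K := isCompact_univ_pi fun _ => isCompact_univ_pi fun _ =>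
    isCompact_univ_pi fun _ => isCompact_closedBall _ _
  have hsub : ∀ W, summedSchattenNorm p W ≤ c → W ∈ K := by
    intro W hW k _ i _ j _
    rw [mem_closedBall_zero_iff]
    refine Real.le_sqrt_of_sq_le ((norm_entry_sq_le hp (W k) i j).trans ?_)
    have h1 : schattenNorm p (W k) ≤ c :=
      (Finset.single_le_sum (f := fun k => schattenNorm p (W k))
        (fun l _ => schattenNorm_nonneg p (W l)) (Finset.mem_univ k)).trans hW
    have h0 := schattenNorm_nonneg p (W k)
    gcongr
  obtain ⟨W, hW, hmin⟩ := (hK.inter_left hclosed).exists_isMinOn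
    ⟨W₀, hW₀, hsub W₀ le_rfl⟩ (hcont.mono Set.inter_subset_left)
  refine ⟨W, hW.1, fun V hV => ?_⟩
  by_cases hVc : summedSchattenNorm p V ≤ c
  · exact hmin ⟨hV, hsub V hVc⟩
  · exact (hmin ⟨hW₀, hsub W₀ le_rfl⟩ : summedSchattenNorm p W ≤ c).trans (not_le.1 hVc).le

theorem balanced_of_isMinOn {p : ℝ} (hp : 0 < p) {X : Matrix (Fin d) (Fin d) 𝕜}
    (hX : IsUnit X) {W : Weights 𝕜 d N} (hW : W ∈ fiber N X)
    (hmin : IsMinOn (summedSchattenNorm p) (fiber N X) W) : W ∈ balancedVariety 𝕜 d N := by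
  intro k hk
  have hW' : IsUnit (endToEnd W) := by rw [show endToEnd W = X from hW]; exact hX
  refine balanced_of_forall_le hp (isUnit_of_isUnit_endToEnd hW' _)
    (isUnit_of_isUnit_endToEnd hW' _) fun G H hGH => ?_
  set i : Fin N := ⟨k, Nat.lt_of_succ_lt hk⟩ with hi
  set j : Fin N := ⟨k + 1, hk⟩ with hj
  have hij : i ≠ j := by simp [hi, hj]
  set V : Weights 𝕜 d N := Function.update (Function.update W j (W j * G)) i (H * W i) with hV
  have hVi : V i = H * W i := by simp [hV]
  have hVj : V j = W j * G := by simp [hV, hij.symm]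
  have hVl : ∀ l, l ≠ i → l ≠ j → V l = W l := fun l h1 h2 => by simp [hV, h1, h2]
  have hfib : V ∈ fiber N X := by
    refine (endToEnd_congr_adjacent k hk (fun l h1 h2 => hVl l ?_ ?_) ?_).trans hW
    · exact fun h => h1 (congrArg Fin.val h)
    · exact fun h => h2 (congrArg Fin.val h)
    · change V j * V i = W j * W i
      rw [hVi, hVj, mul_assoc, ← mul_assoc G, hGH, one_mul]
  have hle : summedSchattenNorm p W ≤ summedSchattenNorm p V := hmin hfib
  have hsplit : ∀ U : Weights 𝕜 d N, summedSchattenNorm p U =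
      schattenNorm p (U i) + (schattenNorm p (U j) +
        ∑ l ∈ (Finset.univ.erase i).erase j, schattenNorm p (U l)) := fun U => by
    rw [Finset.add_sum_erase _ (fun l => schattenNorm p (U l)) (by simp [hij.symm]),
      Finset.add_sum_erase _ (fun l => schattenNorm p (U l)) (Finset.mem_univ i)]
    rfl
  have hrest : ∑ l ∈ (Finset.univ.erase i).erase j, schattenNorm p (V l) =
      ∑ l ∈ (Finset.univ.erase i).erase j, schattenNorm p (W l) :=
    Finset.sum_congr rfl fun l hl => by
      rw [Finset.mem_erase, Finset.mem_erase] at hl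
      rw [hVl l hl.2.1 hl.1]
  rw [hsplit W, hsplit V, hVi, hVj, hrest] at hle
  linarith

/-- Adjacent balanced factors have the same singular values, so all summands equal the norm of `W
0`, whose Gram matrix is the `(N+1)`-th root of that of the product. -/
theorem summedSchattenNorm_of_balanced (p : ℝ) {W : Weights 𝕜 d (N + 1)}
    (hW : W ∈ balancedVariety 𝕜 d (N + 1)) :
    summedSchattenNorm p W = (N + 1) * spectralTrace (· ^ (p / 2 / (N + 1 : ℕ)))
      ((endToEnd W)ᴴ * endToEnd W) ^ (1 / p) := by
  have h : ∀ (k : ℕ) (hk : k < N + 1), schattenNorm p (W ⟨k, hk⟩) = schattenNorm p (W 0) := by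
    intro k
    induction k with
    | zero => exact fun _ => rfl
    | succ k ih =>
      intro hk
      rw [← ih (by omega), schattenNorm_eq, schattenNorm_eq', hW k hk]
  have h0 : schattenNorm p (W 0) = spectralTrace (· ^ (p / 2 / (N + 1 : ℕ)))
      ((endToEnd W)ᴴ * endToEnd W) ^ (1 / p) := by
    rw [conjTranspose_endToEnd_mul_self hW, schattenNorm_eq, spectralTrace_rpow_pow _
      N.succ_ne_zero (posSemidef_conjTranspose_mul_self _)]
  rw [summedSchattenNorm, Finset.sum_congr rfl fun (k : Fin (N + 1)) _ => h k k.2, h0]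
  simp

theorem summedSchattenNorm_eq_of_balanced (p : ℝ) {V W : Weights 𝕜 d N}
    (hV : V ∈ balancedVariety 𝕜 d N) (hW : W ∈ balancedVariety 𝕜 d N)
    (h : endToEnd V = endToEnd W) : summedSchattenNorm p V = summedSchattenNorm p W := by
  cases N with
  | zero => rw [Subsingleton.elim V W]
  | succ N => rw [summedSchattenNorm_of_balanced p hV, summedSchattenNorm_of_balanced p hW, h]

end Minimizers

end DLN

theorem theorem4 {𝕜 : Type*} [RCLike 𝕜] (d N : ℕ) (p : ℝ) (hp : 1 < p)
    (X : Matrix (Fin d) (Fin d) 𝕜) (hX : X.rank = d) :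
    {W : DLN.Weights 𝕜 d N | W ∈ DLN.fiber N X ∧
        IsMinOn (DLN.summedSchattenNorm p) (DLN.fiber N X) W} =
      DLN.fiber N X ∩ DLN.balancedManifold 𝕜 d N := by
  have hp0 : 0 < p := by linarith
  have hXu : IsUnit X := by
    rw [← Matrix.mulVec_surjective_iff_isUnit, ← Matrix.coe_mulVecLin, ← LinearMap.range_eq_top]
    exact Submodule.eq_top_of_finrank_eq (by rwa [Module.finrank_fin_fun])
  ext W
  constructor
  · rintro ⟨hW, hmin⟩
    refine ⟨hW, DLN.balanced_of_isMinOn hp0 hXu hW hmin, ?_⟩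
    rw [show DLN.endToEnd W = X from hW, hX]
  · rintro ⟨hW, hbal, -⟩
    obtain ⟨V, hV, hmin⟩ := DLN.exists_isMinOn_fiber hp0 hXu ⟨W, hW⟩
    refine ⟨hW, fun U hU => ?_⟩
    have hVb := DLN.balanced_of_isMinOn hp0 hXu hV hmin
    have h : DLN.summedSchattenNorm p W = DLN.summedSchattenNorm p V :=
      DLN.summedSchattenNorm_eq_of_balanced p hbal hVb (Eq.trans hW (Eq.symm hV))
    exact h.trans_le (hmin hU)
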